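/- Let $K$ be a non-compact locally compact Hausdorff hypergroup that carries a left-invariant Haar measure $\omega$, i.e. a non-zero Radon measure with $\delta_x*\omega=\omega$ for all $x\in K$. Here $M(K)=C_0(K)^*$ is the space of bounded regular complex Borel measures on $K$, and "hypergroup" means that $M(K)$ carries a bilinear, associative, weakly continuous convolution, given by $$\int_K f\,d(\mu*\nu)=\int_K\int_K f(x*y)\,d\mu(x)\,d\nu(y),\qquad f(x*y)=\int_K f\,d(\delta_x*\delta_y),\quad f\in C_0(K),$$ such that: each $\delta_x*\delta_y$ is a probability measure with compact support; the maps $(x,y)\mapsto\delta_x*\delta_y$ (for the weak$^*$ topology) and $(x,y)\mapsto\operatorname{supp}(\delta_x*\delta_y)$ (for the Michael topology on non-empty compact sets) are continuous; there is an identity $e\in K$ with $\delta_e*\delta_x=\delta_x*\delta_e=\delta_x$; and there is a continuous involution $x\mapsto\check x$ on $K$ with $(\delta_x*\delta_y)\check{}=\delta_{\check y}*\delta_{\check x}$ and $e\in\operatorname{supp}(\delta_x*\delta_y)$ if and only if $x=\check y$. Let $\sigma$ be a regular Borel probability measure on $K$ that is non-degenerate, i.e. $K=\overline{\bigcup_{n\ge1}(\operatorname{supp}\sigma)^n}$,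 where $A*B=\bigcup_{x\in A,\,y\in B}\operatorname{supp}(\delta_x*\delta_y)$ for $A,B\subseteq K$, $A^1=A$ and $A^{n+1}=A^n*A$. Let $\sigma^k$ be the $k$-fold convolution power of $\sigma$. Then $\frac1n\sum_{k=1}^n\sigma^k\to0$ weak$^*$ in $M(K)$, i.e. $$\lim_{n\to\infty}\int_K f\,d\Big(\frac1n\sum_{k=1}^n\sigma^k\Big)=0\qquad\text{for every } f\in C_0(K).$$ -/

import Mathlib

open MeasureTheory Filter Topology Set
open scoped ZeroAtInfty CompactlySupported

/-- The finite regular positive Borel measures on `K`: the positive cone of the space `M(K)` of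
bounded regular complex Borel measures. -/
def PosMeasure (K : Type*) [TopologicalSpace K] [MeasurableSpace K] : Type _ :=
  {μ : Measure K // IsFiniteMeasure μ ∧ μ.Regular}

/-- A weak-star continuous family of regular probability measures on `K` indexed by `K × K`;
`mul x y` plays the role of `δ_x * δ_y`. -/
structure PointConvolution (K : Type*) [TopologicalSpace K] [MeasurableSpace K]
    [OpensMeasurableSpace K] where
  mul : K → K → ProbabilityMeasure K
  regular_mul : ∀ x y, (mul x y : Measure K).Regular
  continuous_mul : Continuous fun p : K × K => mul p.1 p.2

section Auxiliary

variable {K : Type*} [TopologicalSpace K] [MeasurableSpace K]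

theorem regular_dirac_of_t1 [T1Space K] [BorelSpace K] (x : K) :
    (Measure.dirac x).Regular where
  lt_top_of_isCompact := fun _ _ => measure_lt_top _ _
  outerRegular := by
    intro A hA r hr
    by_cases hx : x ∈ A
    · refine ⟨univ, subset_univ _, isOpen_univ, ?_⟩
      rwa [Measure.dirac_apply' _ MeasurableSet.univ, indicator_of_mem (mem_univ x),
        ← indicator_of_mem hx (1 : K → ENNReal), ← Measure.dirac_apply' _ hA]
    · refine ⟨{x}ᶜ, fun y hy h => hx (h ▸ hy), isOpen_compl_singleton, ?_⟩
      rw [Measure.dirac_apply' _ (measurableSet_singleton x).compl]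
      simpa using lt_of_le_of_lt zero_le hr
  innerRegular := by
    intro U hU r hr
    by_cases hx : x ∈ U
    · refine ⟨{x}, singleton_subset_iff.2 hx, isCompact_singleton, ?_⟩
      rw [Measure.dirac_apply' _ hU.measurableSet, indicator_of_mem hx] at hr
      rwa [Measure.dirac_apply' _ (measurableSet_singleton x),
        indicator_of_mem (mem_singleton x)]
    · rw [Measure.dirac_apply' _ hU.measurableSet, indicator_of_notMem hx] at hr
      exact absurd hr not_lt_zero

theorem continuous_integral_of_regular [BorelSpace K] [T2Space K] (μ : Measure K)
    [IsFiniteMeasure μ] [μ.Regular] {φ : K → K → ℝ} (hφ : Continuous fun p : K × K => φ p.1 p.2)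
    {C : ℝ} (hC : ∀ x y, |φ x y| ≤ C) : Continuous fun y => ∫ x, φ x y ∂μ := by
  have hint : ∀ y, Integrable (fun x => φ x y) μ := fun y =>
    Integrable.of_bound (by fun_prop : Continuous fun x => φ x y).aestronglyMeasurable C
      (Eventually.of_forall fun x => hC x y)
  rw [continuous_iff_continuousAt]
  intro y₀
  have hC0 : 0 ≤ C := (abs_nonneg _).trans (hC y₀ y₀)
  rw [ContinuousAt, Metric.tendsto_nhds]
  intro ε hε
  set m : ℝ := μ.real univ
  have hm : 0 ≤ m := measureReal_nonneg
  set η : ℝ := ε / (m + 2 * C + 2)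
  have hη : 0 < η := by positivity
  obtain ⟨S, -, hS, hSμ⟩ := MeasurableSet.univ.exists_isCompact_sdiff_lt (μ := μ)
    (measure_ne_top μ _) (ε := ENNReal.ofReal η) (by simpa using hη)
  have hSm : MeasurableSet S := hS.measurableSet
  have hSμ' : μ.real Sᶜ ≤ η := by
    rw [compl_eq_univ_sdiff, measureReal_def]
    exact ENNReal.toReal_le_of_le_ofReal hη.le hSμ.le
  have hev : ∀ᶠ y in 𝓝 y₀, ∀ x ∈ S, |φ x y - φ x y₀| < η := by
    refine hS.eventually_forall_of_forall_eventually fun x _ => ?_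
    have h1 : Continuous fun p : K × K => |φ p.2 p.1 - φ p.2 y₀| := by fun_prop
    refine (h1.tendsto (y₀, x)).eventually_lt_const ?_
    simpa using hη
  filter_upwards [hev] with y hy
  rw [Real.dist_eq, ← integral_sub (hint y) (hint y₀)]
  have hi : Integrable (fun x => φ x y - φ x y₀) μ := (hint y).sub (hint y₀)
  rw [← integral_add_compl hSm hi]
  have e1 : |∫ x in S, (φ x y - φ x y₀) ∂μ| ≤ η * m := by
    have := norm_setIntegral_le_of_norm_le_const (μ := μ) (measure_lt_top μ S)
      (f := fun x => φ x y - φ x y₀) (C := η) (fun x hx => (hy x hx).le)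
    refine this.trans ?_
    exact mul_le_mul_of_nonneg_left (measureReal_mono (subset_univ _)) hη.le
  have e2 : |∫ x in Sᶜ, (φ x y - φ x y₀) ∂μ| ≤ (2 * C) * η := by
    have := norm_setIntegral_le_of_norm_le_const (μ := μ) (measure_lt_top μ Sᶜ)
      (f := fun x => φ x y - φ x y₀) (C := 2 * C) (fun x _ => by
        rw [Real.norm_eq_abs]
        have := abs_sub (φ x y) (φ x y₀)
        linarith [hC x y, hC x y₀])
    exact this.trans (mul_le_mul_of_nonneg_left hSμ' (by positivity))
  calc _ ≤ η * m + 2 * C * η := (abs_add_le _ _).trans (add_le_add e1 e2)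
    _ < η * (m + 2 * C + 2) := by nlinarith
    _ = ε := div_mul_cancel₀ _ (by positivity)

end Auxiliary

namespace PointConvolution

variable {K : Type*} [TopologicalSpace K] [MeasurableSpace K] [BorelSpace K]
  (H : PointConvolution K)

/-- `f(x * y) = ∫ f d(δ_x * δ_y)`. -/
noncomputable def translate (f : K → ℝ) (x y : K) : ℝ := ∫ t, f t ∂(H.mul x y : Measure K)

theorem continuous_translate (f : C_c(K, ℝ)) :
    Continuous fun p : K × K => H.translate f p.1 p.2 := by
  obtain ⟨C, hC⟩ := f.hasCompactSupport.exists_bound_of_continuous f.continuous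
  exact (ProbabilityMeasure.continuous_integral_boundedContinuousFunction
    (BoundedContinuousFunction.ofNormedAddCommGroup f f.continuous C hC)).comp H.continuous_mul

theorem abs_translate_le {f : K → ℝ} {C : ℝ} (hC : ∀ t, |f t| ≤ C) (x y : K) :
    |H.translate f x y| ≤ C := by
  have := norm_integral_le_of_norm_le_const (μ := (H.mul x y : Measure K)) (f := f) (C := C)
    (Eventually.of_forall hC)
  simpa [translate] using this

theorem integrable_inner (μ : Measure K) [IsFiniteMeasure μ] (f : C_c(K, ℝ)) (y : K) :
    Integrable (fun x => H.translate f x y) μ := by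
  obtain ⟨C, hC⟩ := f.hasCompactSupport.exists_bound_of_continuous f.continuous
  have h := H.continuous_translate f
  exact Integrable.of_bound
    (h.comp (by fun_prop : Continuous fun x : K => (x, y))).aestronglyMeasurable C
    (Eventually.of_forall fun x => H.abs_translate_le hC x y)

theorem integrable_outer [T2Space K] (μ ν : Measure K) [IsFiniteMeasure μ] [μ.Regular]
    [IsFiniteMeasure ν] (f : C_c(K, ℝ)) :
    Integrable (fun y => ∫ x, H.translate f x y ∂μ) ν := by
  obtain ⟨C, hC⟩ := f.hasCompactSupport.exists_bound_of_continuous f.continuous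
  exact Integrable.of_bound
    (continuous_integral_of_regular μ (H.continuous_translate f)
      (H.abs_translate_le hC)).aestronglyMeasurable (C * μ.real univ)
    (Eventually.of_forall fun y => norm_integral_le_of_norm_le_const
      (Eventually.of_forall fun x => H.abs_translate_le hC x y))

/-- The positive functional `f ↦ ∫∫ f(x * y) dμ(x) dν(y)` on `C_c(K)`. -/
noncomputable def functional [T2Space K] (μ ν : PosMeasure K) : C_c(K, ℝ) →ₚ[ℝ] ℝ :=
  haveI := μ.2.1
  haveI := ν.2.1
  haveI := μ.2.2
  PositiveLinearMap.mk₀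
    { toFun := fun f => ∫ y, ∫ x, H.translate f x y ∂μ.1 ∂ν.1
      map_add' := fun f g => by
        rw [← integral_add (H.integrable_outer μ.1 ν.1 f) (H.integrable_outer μ.1 ν.1 g)]
        refine integral_congr_ae (Eventually.of_forall fun y => ?_)
        dsimp only
        rw [← integral_add (H.integrable_inner μ.1 f y) (H.integrable_inner μ.1 g y)]
        refine integral_congr_ae (Eventually.of_forall fun x => ?_)
        exact integral_add (f.continuous.integrable_of_hasCompactSupport f.hasCompactSupport)
          (g.continuous.integrable_of_hasCompactSupport g.hasCompactSupport)
      map_smul' := fun c f => by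
        simp [translate, integral_const_mul] }
    fun f hf => integral_nonneg fun y => integral_nonneg fun x => integral_nonneg fun t => hf t

/-- The convolution `μ * ν`: the regular measure with
`∫ f d(μ * ν) = ∫∫ f(x * y) dμ(x) dν(y)`, obtained from the Riesz representation theorem. -/
noncomputable def convolve [T2Space K] [LocallyCompactSpace K] (μ ν : PosMeasure K) :
    PosMeasure K :=
  ⟨RealRMK.rieszMeasure (H.functional μ ν), by
    have := μ.2.1
    have := ν.2.1
    have := μ.2.2
    refine ⟨⟨?_⟩, inferInstance⟩
    rw [isOpen_univ.measure_eq_iSup_isCompact]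
    refine lt_of_le_of_lt (b := ENNReal.ofReal (μ.1.real univ * ν.1.real univ))
      (iSup₂_le fun S _ => iSup_le fun hS => ?_) ENNReal.ofReal_lt_top
    obtain ⟨f, hf1, -, hfc, hf01⟩ :=
      exists_continuous_one_zero_of_isCompact hS isClosed_empty (disjoint_empty S)
    let g : C_c(K, ℝ) := ⟨f, hfc⟩
    have hg : ∀ t, |g t| ≤ 1 := fun t => abs_le.2 ⟨(by norm_num : (-1 : ℝ) ≤ 0).trans (hf01 t).1, (hf01 t).2⟩
    refine (RealRMK.rieszMeasure_le_of_eq_one _ (f := g) (fun x => (hf01 x).1) hS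
      (fun x hx => hf1 hx)).trans (ENNReal.ofReal_le_ofReal ?_)
    refine (le_abs_self _).trans ?_
    change ‖∫ y, ∫ x, H.translate g x y ∂μ.1 ∂ν.1‖ ≤ _
    refine norm_integral_le_of_norm_le_const (Eventually.of_forall fun y => ?_)
    refine (norm_integral_le_of_norm_le_const (C := 1)
      (Eventually.of_forall fun x => H.abs_translate_le hg x y)).trans ?_
    rw [one_mul]⟩

theorem integral_convolve [T2Space K] [LocallyCompactSpace K] (μ ν : PosMeasure K)
    (f : C_c(K, ℝ)) :
    ∫ t, f t ∂(H.convolve μ ν).1 = ∫ y, ∫ x, H.translate f x y ∂μ.1 ∂ν.1 :=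
  RealRMK.integral_rieszMeasure _ f

end PointConvolution

/-- A (locally compact) hypergroup. The bilinear convolution on `M(K)` is given by the measures
`mul x y = δ_x * δ_y` through `PointConvolution.convolve`; associativity on `M(K)` is, by
bilinearity, associativity on its positive cone. -/
structure Hypergroup (K : Type*) [TopologicalSpace K] [T2Space K] [LocallyCompactSpace K]
    [MeasurableSpace K] [BorelSpace K] extends PointConvolution K where
  assoc : ∀ μ ν ρ : PosMeasure K, toPointConvolution.convolve
    (toPointConvolution.convolve μ ν) ρ = toPointConvolution.convolve μ
      (toPointConvolution.convolve ν ρ)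
  isCompact_support : ∀ x y, IsCompact (mul x y : Measure K).support
  /-- `(x, y) ↦ supp (δ_x * δ_y)` is continuous for the Michael (Vietoris) topology. -/
  continuous_support : Continuous[inferInstance, TopologicalSpace.vietoris K]
    fun p : K × K => (mul p.1 p.2 : Measure K).support
  /-- The identity `e`. -/
  e : K
  e_mul : ∀ x, (mul e x : Measure K) = Measure.dirac x
  mul_e : ∀ x, (mul x e : Measure K) = Measure.dirac x
  /-- The involution `x ↦ x̌`. -/
  inv : K → K
  continuous_inv : Continuous inv
  inv_inv : ∀ x, inv (inv x) = x
  map_inv_mul : ∀ x y, (mul x y : Measure K).map inv = (mul (inv y) (inv x) : Measure K)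
  e_mem_support_iff : ∀ x y, e ∈ (mul x y : Measure K).support ↔ x = inv y

namespace Hypergroup

variable {K : Type*} [TopologicalSpace K] [T2Space K] [LocallyCompactSpace K]
  [MeasurableSpace K] [BorelSpace K] (H : Hypergroup K)

/-- `ω` is a left Haar measure: a nonzero Radon measure with `δ_x * ω = ω` for all `x`. -/
structure IsLeftHaar (ω : Measure K) : Prop where
  regular : ω.Regular
  ne_zero : ω ≠ 0
  invariant : ∀ (x : K) (f : C_c(K, ℝ)), ∫ y, H.translate f x y ∂ω = ∫ y, f y ∂ω

/-- The point mass `δ_e`. -/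
noncomputable def diracE : PosMeasure K :=
  ⟨Measure.dirac H.e, inferInstance, regular_dirac_of_t1 H.e⟩

/-- The convolution powers: `σ⁰ = δ_e` and `σⁿ⁺¹ = σⁿ * σ`. -/
noncomputable def power (σ : PosMeasure K) : ℕ → PosMeasure K
  | 0 => H.diracE
  | n + 1 => H.convolve (power σ n) σ

/-- The measure `(1/n) ∑_{k=1}^n σᵏ`. -/
noncomputable def cesaro (σ : PosMeasure K) (n : ℕ) : Measure K :=
  ((n : NNReal)⁻¹) • ∑ k ∈ Finset.Icc 1 n, (H.power σ k).1

/-- The product of sets `A * B = ⋃_{x ∈ A, y ∈ B} supp (δ_x * δ_y)`. -/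
def setMul (A B : Set K) : Set K :=
  ⋃ x ∈ A, ⋃ y ∈ B, (H.mul x y : Measure K).support

/-- The powers of a set: `A⁰ = {e}` and `Aⁿ⁺¹ = Aⁿ * A`. -/
def setPow (A : Set K) : ℕ → Set K
  | 0 => {H.e}
  | n + 1 => H.setMul (setPow A n) A

/-- `σ` is non-degenerate: `⋃_{n ≥ 1} (supp σ)ⁿ` is dense in `K`. -/
def IsNondegenerate (σ : PosMeasure K) : Prop :=
  closure (⋃ n : ℕ, ⋃ _ : 1 ≤ n, H.setPow σ.1.support n) = univ

end Hypergroup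

/-! ### Cutoff functions and approximation in `C₀(K)`. -/

section Cutoff

variable {K : Type*} [TopologicalSpace K]

/-! The averages have mass at most one, so along any ultrafilter they converge weak-star to a
positive regular measure μ (`exists_regular_tendsto_ultrafilter`); it suffices to show μ = 0.
Telescoping (`tendsto_integral_rightAverage_sub`) gives μ * σ = μ. For f in `C_c(K)` put g(y) = ∫
f(x * y) dμ(x). Then g lies in `C₀(K)`, associativity gives g(y) = ∫ g d(σ * δ_y), and g(e) = ∫ f
dμ. If g were positive somewhere, it would attain a positive maximum. Harmonicity makes the closed
set of maximum points stable under left multiplication by supp σ, so by non-degeneracy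
(`eq_univ_of_setMul_subset`) it is all of K, and g is a nonzero constant. This is absurd on a
non-compact space. Hence ∫ f dμ ≤ 0, and the same for -f gives equality.

Group inverses are replaced by `right_mem_support` and `left_mem_support`, which follow from the
involution axiom and associativity of supports. They confine the zeros-free region of a translate of
f to a compact set, so that averages of translates vanish at infinity. This decay also yields Fubini
without any countability assumption on K. -/

theorem exists_abs_le_of_tendsto_cocompact {g : K → ℝ} (hg : Continuous g)
    (hg0 : Tendsto g (cocompact K) (𝓝 0)) : ∃ C, ∀ x, |g x| ≤ C := by
  obtain ⟨S, hS, hSg⟩ := mem_cocompact.1 (hg0 (Metric.ball_mem_nhds 0 one_pos))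
  obtain ⟨C, hC⟩ := hS.exists_bound_of_continuousOn hg.continuousOn
  refine ⟨max C 1, fun x => ?_⟩
  by_cases hx : x ∈ S
  · exact (hC x hx).trans (le_max_left _ _)
  · have := hSg hx
    simp only [mem_preimage, mem_ball_zero_iff, Real.norm_eq_abs] at this
    exact this.le.trans (le_max_right _ _)

theorem CompactlySupportedContinuousMap.exists_abs_le (f : C_c(K, ℝ)) : ∃ C, ∀ x, |f x| ≤ C :=
  f.hasCompactSupport.exists_bound_of_continuous f.continuous

/-- `φ x y` vanishes at infinity in `y`, locally uniformly in `x`. -/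
def LocallyUniformlyVanishing (φ : K → K → ℝ) : Prop :=
  ∀ S, IsCompact S → ∃ T, IsCompact T ∧ ∀ x ∈ S, ∀ y ∉ T, φ x y = 0

variable [T2Space K] [LocallyCompactSpace K]

/-- Compactly supported cutoff functions that are `1` on a given compact set. -/
theorem exists_cutoff {S : Set K} (hS : IsCompact S) :
    ∃ χ : C_c(K, ℝ), (∀ x, 0 ≤ χ x) ∧ (∀ x, χ x ≤ 1) ∧ ∀ x ∈ S, χ x = 1 := by
  obtain ⟨f, hf1, -, hfc, hf01⟩ :=
    exists_continuous_one_zero_of_isCompact hS isClosed_empty (disjoint_empty S)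
  exact ⟨⟨f, hfc⟩, fun x => (hf01 x).1, fun x => (hf01 x).2, fun x hx => hf1 hx⟩

theorem exists_separating {S : Set K} (hS : IsClosed S) {t : K} (ht : t ∉ S) :
    ∃ f : C_c(K, ℝ), (∀ x, 0 ≤ f x) ∧ 0 < f t ∧ ∀ x ∈ S, f x = 0 := by
  obtain ⟨f, hf1, hf0, hfc, hf01⟩ := exists_continuous_one_zero_of_isCompact
    (isCompact_singleton (x := t)) hS (disjoint_singleton_left.2 ht)
  refine ⟨⟨f, hfc⟩, fun x => (hf01 x).1, ?_, fun x hx => hf0 hx⟩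
  change 0 < f t
  rw [hf1 (mem_singleton t)]
  exact one_pos

theorem exists_compactlySupported_abs_sub_le {k : K → ℝ} (hk : Continuous k)
    (hk0 : Tendsto k (cocompact K) (𝓝 0)) {ε : ℝ} (hε : 0 < ε) :
    ∃ g : C_c(K, ℝ), ∀ x, |k x - g x| ≤ ε := by
  obtain ⟨S, hS, hSg⟩ := mem_cocompact.1 (hk0 (Metric.ball_mem_nhds 0 hε))
  obtain ⟨χ, h0, h1, hχS⟩ := exists_cutoff hS
  refine ⟨⟨⟨fun x => χ x * k x, χ.continuous.mul hk⟩, χ.hasCompactSupport.mul_right⟩,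
    fun x => ?_⟩
  change |k x - χ x * k x| ≤ ε
  by_cases hx : x ∈ S
  · rw [hχS x hx, one_mul, sub_self, abs_zero]
    exact hε.le
  · have := hSg hx
    simp only [mem_preimage, mem_ball_zero_iff, Real.norm_eq_abs] at this
    have e : k x - χ x * k x = (1 - χ x) * k x := by ring
    rw [e, abs_mul]
    calc |1 - χ x| * |k x| ≤ 1 * |k x| :=
          mul_le_mul_of_nonneg_right (abs_le.2 ⟨by linarith [h1 x], by linarith [h0 x]⟩)
            (abs_nonneg _)
      _ ≤ ε := by rw [one_mul]; exact this.le

end Cutoff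

/-! ### Bounded measures: supports, tails, weak-star limits, Fubini. -/

section VanishingAtInfinity

theorem mem_support_dirac {K : Type*} [TopologicalSpace K] [MeasurableSpace K] (x : K) :
    x ∈ (Measure.dirac x).support := by
  rw [Measure.mem_support_iff_forall]
  intro U hU
  rw [Measure.dirac_apply_of_mem (mem_of_mem_nhds hU)]
  exact one_pos

theorem integral_eq_zero_of_eqOn_support {K : Type*} [TopologicalSpace K] [MeasurableSpace K]
    {μ : Measure K} [μ.Regular] {g : K → ℝ}
    (hg : ∀ x ∈ μ.support, g x = 0) : ∫ x, g x ∂μ = 0 :=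
  integral_eq_zero_of_ae (by
    filter_upwards [Measure.support_mem_ae_of_regular (μ := μ)] with x hx using hg x hx)

theorem abs_integral_le_mul {K : Type*} [MeasurableSpace K] {μ : Measure K} [IsFiniteMeasure μ]
    {g : K → ℝ} {C : ℝ} (hC : ∀ x, |g x| ≤ C) : |∫ x, g x ∂μ| ≤ C * μ.real univ :=
  norm_integral_le_of_norm_le_const (f := g) (Eventually.of_forall hC)

theorem abs_integral_le_of_measure_le_one {K : Type*} [MeasurableSpace K] {μ : Measure K}
    (hμ : μ univ ≤ 1) {g : K → ℝ} {C : ℝ} (hC0 : 0 ≤ C) (hC : ∀ x, |g x| ≤ C) :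
    |∫ x, g x ∂μ| ≤ C := by
  have : IsFiniteMeasure μ := ⟨hμ.trans_lt ENNReal.one_lt_top⟩
  refine (abs_integral_le_mul hC).trans (mul_le_of_le_one_right hC0 ?_)
  rw [measureReal_def]
  exact ENNReal.toReal_le_of_le_ofReal zero_le_one (by simpa using hμ)

variable {K : Type*} [TopologicalSpace K] [MeasurableSpace K] [BorelSpace K]

theorem integrable_of_continuous_of_bounded {μ : Measure K} [IsFiniteMeasure μ] {g : K → ℝ}
    (hg : Continuous g) {C : ℝ} (hC : ∀ x, |g x| ≤ C) : Integrable g μ :=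
  Integrable.of_bound hg.aestronglyMeasurable C (Eventually.of_forall hC)

theorem integral_pos_of_mem_support {μ : Measure K} [IsFiniteMeasure μ] {g : K → ℝ}
    (hg : Continuous g) (h0 : ∀ x, 0 ≤ g x) {C : ℝ} (hC : ∀ x, |g x| ≤ C) {t : K}
    (ht : t ∈ μ.support) (hgt : 0 < g t) : 0 < ∫ x, g x ∂μ := by
  rw [integral_pos_iff_support_of_nonneg h0 (integrable_of_continuous_of_bounded hg hC)]
  refine (Measure.mem_support_iff_forall t).1 ht _ (hg.isOpen_support.mem_nhds ?_)
  exact hgt.ne'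

theorem abs_integral_sub_le_of_abs_sub_le {μ : Measure K} (hμ : μ univ ≤ 1) {k : K → ℝ}
    (hk : Continuous k)
    {C : ℝ} (hC : ∀ x, |k x| ≤ C) {ε : ℝ} (hε : 0 ≤ ε) {g : C_c(K, ℝ)}
    (hg : ∀ x, |k x - g x| ≤ ε) : |∫ x, k x ∂μ - ∫ x, g x ∂μ| ≤ ε := by
  have : IsFiniteMeasure μ := ⟨hμ.trans_lt ENNReal.one_lt_top⟩
  obtain ⟨D, hD⟩ := g.exists_abs_le
  rw [← integral_sub (f := k) (g := g) (integrable_of_continuous_of_bounded hk hC)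
    (integrable_of_continuous_of_bounded g.continuous hD)]
  exact abs_integral_le_of_measure_le_one hμ hε hg

variable [T2Space K] [LocallyCompactSpace K]

/-- Inner regularity puts all but δ of the mass on a compact set where χ = 1. The same χ serves
every h, which allows kernels h = φ(·, y) to be treated uniformly in y. -/
theorem exists_cutoff_integral_le (μ : Measure K) [IsFiniteMeasure μ] [μ.Regular] {δ : ℝ}
    (hδ : 0 < δ) : ∃ χ : C_c(K, ℝ), (∀ x, 0 ≤ χ x) ∧ (∀ x, χ x ≤ 1) ∧
      ∀ (h : K → ℝ) (C : ℝ), Continuous h → 0 ≤ C → (∀ x, |h x| ≤ C) →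
        |∫ x, (1 - χ x) * h x ∂μ| ≤ C * δ := by
  obtain ⟨S, -, hS, hSμ⟩ := MeasurableSet.univ.exists_isCompact_sdiff_lt (μ := μ)
    (measure_ne_top μ _) (ε := ENNReal.ofReal δ) (by simpa using hδ)
  have hSm : MeasurableSet S := hS.measurableSet
  have hSμ' : μ.real Sᶜ ≤ δ := by
    rw [compl_eq_univ_sdiff, measureReal_def]
    exact ENNReal.toReal_le_of_le_ofReal hδ.le hSμ.le
  obtain ⟨χ, h0, h1, hχS⟩ := exists_cutoff hS
  refine ⟨χ, h0, h1, fun h C hh hC0 hC => ?_⟩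
  have hb : ∀ x, |(1 - χ x) * h x| ≤ C := fun x => by
    rw [abs_mul]
    calc |1 - χ x| * |h x| ≤ 1 * |h x| :=
          mul_le_mul_of_nonneg_right (abs_le.2 ⟨by linarith [h1 x], by linarith [h0 x]⟩)
            (abs_nonneg _)
      _ ≤ C := by simpa using hC x
  have hi : Integrable (fun x => (1 - χ x) * h x) μ :=
    integrable_of_continuous_of_bounded ((continuous_const.sub χ.continuous).mul hh) hb
  rw [← integral_add_compl hSm hi, setIntegral_eq_zero_of_forall_eq_zero
    (fun x hx => by rw [hχS x hx]; ring), zero_add]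
  refine (norm_setIntegral_le_of_norm_le_const (measure_lt_top μ Sᶜ)
    (f := fun x => (1 - χ x) * h x) (C := C) (fun x _ => hb x)).trans ?_
  exact mul_le_mul_of_nonneg_left hSμ' hC0

/-- For measures of mass at most one, convergence on `C_c(K)` implies convergence on `C₀(K)`. -/
theorem tendsto_integral_of_tendsto_compactlySupported {ι : Type*} {l : Filter ι}
    {m : ι → Measure K} (hm : ∀ i, m i univ ≤ 1) {μ : Measure K} (hμ : μ univ ≤ 1)
    (h : ∀ f : C_c(K, ℝ), Tendsto (fun i => ∫ x, f x ∂(m i)) l (𝓝 (∫ x, f x ∂μ)))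
    {k : K → ℝ} (hk : Continuous k) (hk0 : Tendsto k (cocompact K) (𝓝 0)) :
    Tendsto (fun i => ∫ x, k x ∂(m i)) l (𝓝 (∫ x, k x ∂μ)) := by
  obtain ⟨C, hC⟩ := exists_abs_le_of_tendsto_cocompact hk hk0
  rw [Metric.tendsto_nhds]
  intro ε hε
  obtain ⟨g, hg⟩ := exists_compactlySupported_abs_sub_le hk hk0 (ε := ε / 3) (by positivity)
  filter_upwards [Metric.tendsto_nhds.1 (h g) (ε / 3) (by positivity)] with i hi
  have h1 := abs_le.1 (abs_integral_sub_le_of_abs_sub_le (hm i) hk hC (by positivity) hg)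
  have h2 := abs_le.1 (abs_integral_sub_le_of_abs_sub_le hμ hk hC (by positivity) hg)
  rw [Real.dist_eq, abs_lt] at hi ⊢
  constructor <;> linarith [h1.1, h1.2, h2.1, h2.2, hi.1, hi.2]

/-- Weak-star compactness of the positive part of the unit ball of `M(K)`. -/
theorem exists_regular_tendsto_ultrafilter {ι : Type*} (U : Ultrafilter ι) {m : ι → Measure K}
    (hm : ∀ i, m i univ ≤ 1) : ∃ μ : Measure K, μ.Regular ∧ μ univ ≤ 1 ∧
      ∀ f : C_c(K, ℝ), Tendsto (fun i => ∫ x, f x ∂(m i)) U (𝓝 (∫ x, f x ∂μ)) := by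
  have hfin : ∀ i, IsFiniteMeasure (m i) := fun i => ⟨(hm i).trans_lt ENNReal.one_lt_top⟩
  have hex : ∀ f : C_c(K, ℝ), ∃ a : ℝ, Tendsto (fun i => ∫ x, f x ∂(m i)) U (𝓝 a) := by
    intro f
    obtain ⟨C, hC⟩ := f.exists_abs_le
    -- On an empty K the bound `C` may be negative, hence `max C 0`.
    have hC' : ∀ x, |f x| ≤ max C 0 := fun x => (hC x).trans (le_max_left _ _)
    obtain ⟨a, -, ha⟩ := (isCompact_Icc (a := -max C 0) (b := max C 0)).ultrafilter_le_nhds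
      (U.map fun i => ∫ x, f x ∂(m i)) (by
        rw [le_principal_iff]
        exact Eventually.of_forall (f := (U : Filter ι)) fun i => abs_le.1
          (abs_integral_le_of_measure_le_one (hm i) (le_max_right C 0) hC'))
    exact ⟨a, ha⟩
  choose L hL using hex
  have hint : ∀ (f : C_c(K, ℝ)) i, Integrable (fun x => f x) (m i) := fun f i =>
    f.continuous.integrable_of_hasCompactSupport f.hasCompactSupport
  let Λ : C_c(K, ℝ) →ₚ[ℝ] ℝ := PositiveLinearMap.mk₀
    { toFun := L
      map_add' := fun f g => tendsto_nhds_unique (hL (f + g)) (by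
        refine ((hL f).add (hL g)).congr fun i => ?_
        exact (integral_add (hint f i) (hint g i)).symm)
      map_smul' := fun c f => tendsto_nhds_unique (hL (c • f)) (by
        refine ((hL f).const_mul c).congr fun i => ?_
        exact (integral_const_mul c _).symm) }
    fun f hf => ge_of_tendsto' (hL f) fun i => integral_nonneg fun x => hf x
  refine ⟨RealRMK.rieszMeasure Λ, inferInstance, ?_, fun f => ?_⟩
  · rw [isOpen_univ.measure_eq_iSup_isCompact]
    refine iSup₂_le fun S _ => iSup_le fun hS => ?_
    obtain ⟨χ, h0, h1, hχS⟩ := exists_cutoff hS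
    refine (RealRMK.rieszMeasure_le_of_eq_one _ h0 hS hχS).trans ?_
    rw [← ENNReal.ofReal_one]
    refine ENNReal.ofReal_le_ofReal (le_of_tendsto' (hL χ) fun i => ?_)
    exact (le_abs_self _).trans (abs_integral_le_of_measure_le_one (hm i) zero_le_one
      fun x => abs_le.2 ⟨by linarith [h0 x], h1 x⟩)
  · rw [RealRMK.integral_rieszMeasure]
    exact hL f

/-- Up to a small tail, μ lives on the support of a cutoff χ. For y outside one compact set the
kernel vanishes on that support, so only the tail contributes. -/
theorem LocallyUniformlyVanishing.tendsto_integral {φ : K → K → ℝ}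
    (h : LocallyUniformlyVanishing φ) (hφ : Continuous fun p : K × K => φ p.1 p.2) {C : ℝ}
    (hC : ∀ x y, |φ x y| ≤ C) (μ : Measure K) [IsFiniteMeasure μ] [μ.Regular] :
    Tendsto (fun y => ∫ x, φ x y ∂μ) (cocompact K) (𝓝 0) := by
  rw [Metric.tendsto_nhds]
  intro ε hε
  obtain ⟨χ, h0, h1, hχ⟩ := exists_cutoff_integral_le μ (δ := ε / (|C| + 1)) (by positivity)
  obtain ⟨T, hT, hTφ⟩ := h _ χ.hasCompactSupport
  refine mem_cocompact.2 ⟨T, hT, fun y hy => ?_⟩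
  have e : ∀ x, φ x y = (1 - χ x) * φ x y := fun x => by
    by_cases hx : x ∈ tsupport χ
    · rw [hTφ x hx y hy, mul_zero]
    · rw [image_eq_zero_of_notMem_tsupport hx]
      ring
  have hb := hχ (fun x => φ x y) |C|
    (hφ.comp (by fun_prop : Continuous fun x : K => (x, y)))
    (abs_nonneg C) (fun x => (hC x y).trans (le_abs_self C))
  change dist (∫ x, φ x y ∂μ) 0 < ε
  rw [integral_congr_ae (Eventually.of_forall e), Real.dist_eq, sub_zero]
  refine hb.trans_lt ?_
  rw [← mul_div_assoc, div_lt_iff₀ (by positivity)]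
  nlinarith

/-- Fubini's theorem for continuous kernels and regular measures. -/
theorem LocallyUniformlyVanishing.integral_integral_swap {φ : K → K → ℝ}
    (h : LocallyUniformlyVanishing φ) (hφ : Continuous fun p : K × K => φ p.1 p.2) {C : ℝ}
    (hC : ∀ x y, |φ x y| ≤ C) (μ ν : Measure K) [IsFiniteMeasure μ] [μ.Regular]
    [IsFiniteMeasure ν] [ν.Regular] :
    ∫ y, ∫ x, φ x y ∂μ ∂ν = ∫ x, ∫ y, φ x y ∂ν ∂μ := by
  have hφ' : Continuous fun p : K × K => φ p.2 p.1 := hφ.comp continuous_swap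
  have hx : ∀ y, Continuous fun x => φ x y := fun y =>
    hφ.comp (by fun_prop : Continuous fun x : K => (x, y))
  refine eq_of_forall_dist_le fun ε hε => ?_
  set N : ℝ := ν.real univ
  have hN : 0 ≤ N := measureReal_nonneg
  -- Replacing φ by χφ costs |C|Nη in each iterated integral; the two errors together must not
  -- exceed ε.
  set η : ℝ := ε / (2 * (|C| * N + 1))
  have hη : 0 < η := by positivity
  obtain ⟨χ, h0, h1, hχ⟩ := exists_cutoff_integral_le μ (δ := η) hη
  obtain ⟨T, hT, hTφ⟩ := h _ χ.hasCompactSupport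
  have hC' : ∀ x y, |φ x y| ≤ |C| := fun x y => (hC x y).trans (le_abs_self C)
  have hψ : Continuous fun p : K × K => χ p.1 * φ p.1 p.2 :=
    (χ.continuous.comp continuous_fst).mul hφ
  have hψC : ∀ x y, |χ x * φ x y| ≤ |C| := fun x y => by
    rw [abs_mul, abs_of_nonneg (h0 x)]
    exact (mul_le_of_le_one_left (abs_nonneg _) (h1 x)).trans (hC' x y)
  -- Local uniform vanishing makes χ(x)φ(x, y) compactly supported on K × K, where the order of
  -- integration can be exchanged even if the measures on the product are not handled by a countable
  -- base.
  have hsupp : HasCompactSupport (Function.uncurry fun x y => χ x * φ x y) := by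
    refine HasCompactSupport.intro (χ.hasCompactSupport.isCompact.prod hT) ?_
    rintro ⟨x, y⟩ hxy
    change χ x * φ x y = 0
    by_cases hx : x ∈ tsupport χ
    · rw [hTφ x hx y fun hy => hxy ⟨hx, hy⟩, mul_zero]
    · rw [image_eq_zero_of_notMem_tsupport hx, zero_mul]
  have hswap := integral_integral_swap_of_hasCompactSupport (μ := μ) (ν := ν)
    (f := fun x y => χ x * φ x y) hψ hsupp
  have hFc : Continuous fun y => ∫ x, φ x y ∂μ := continuous_integral_of_regular μ hφ hC
  have hGc : Continuous fun x => ∫ y, φ x y ∂ν :=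
    continuous_integral_of_regular ν (φ := fun y x => φ x y) hφ' fun x y => hC y x
  have hFψ : Continuous fun y => ∫ x, χ x * φ x y ∂μ :=
    continuous_integral_of_regular μ (φ := fun x y => χ x * φ x y) hψ hψC
  have hGb : ∀ x, |∫ y, φ x y ∂ν| ≤ |C| * N := fun x =>
    abs_integral_le_mul fun y => hC' x y
  have e1 : |∫ y, ∫ x, φ x y ∂μ ∂ν - ∫ y, ∫ x, χ x * φ x y ∂μ ∂ν| ≤ |C| * η * N := by
    rw [← integral_sub
      (integrable_of_continuous_of_bounded hFc (C := |C| * μ.real univ) fun y =>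
        abs_integral_le_mul fun x => hC' x y)
      (integrable_of_continuous_of_bounded hFψ (C := |C| * μ.real univ) fun y =>
        abs_integral_le_mul fun x => hψC x y)]
    refine abs_integral_le_mul fun y => ?_
    rw [← integral_sub (integrable_of_continuous_of_bounded (hx y) fun x => hC' x y)
      (integrable_of_continuous_of_bounded 
        (g := fun x => χ x * φ x y) (χ.continuous.mul (hx y)) fun x => hψC x y)]
    refine le_trans (le_of_eq ?_) (hχ (fun x => φ x y) |C| (hx y) (abs_nonneg C) fun x => hC' x y)
    congr 2
    ext x
    ring
  have e2 : |∫ x, ∫ y, φ x y ∂ν ∂μ - ∫ x, ∫ y, χ x * φ x y ∂ν ∂μ| ≤ |C| * N * η := by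
    simp_rw [integral_const_mul]
    rw [← integral_sub (integrable_of_continuous_of_bounded hGc hGb)
      (integrable_of_continuous_of_bounded (C := |C| * N)
        (g := fun x => χ x * ∫ y, φ x y ∂ν) (χ.continuous.mul hGc) fun x => by
        rw [abs_mul, abs_of_nonneg (h0 x)]
        exact (mul_le_of_le_one_left (abs_nonneg _) (h1 x)).trans (hGb x))]
    refine le_trans (le_of_eq ?_) (hχ _ _ hGc (by positivity) hGb)
    congr 2
    ext x
    ring
  rw [hswap] at e2
  have e3 : |C| * N * η + |C| * N * η ≤ ε := by
    have : η * (2 * (|C| * N + 1)) = ε := div_mul_cancel₀ _ (by positivity)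
    nlinarith
  rw [Real.dist_eq]
  rw [abs_le] at e1 e2 ⊢
  constructor <;> nlinarith [e1.1, e1.2, e2.1, e2.2]

end VanishingAtInfinity

/-! ### Positivity and vanishing of translates. -/

namespace PointConvolution

variable {K : Type*} [TopologicalSpace K] [MeasurableSpace K] [BorelSpace K]
  (H : PointConvolution K)

theorem translate_pos {f : C_c(K, ℝ)} (hf : ∀ x, 0 ≤ f x) {x y t : K}
    (ht : t ∈ (H.mul x y : Measure K).support) (hft : 0 < f t) : 0 < H.translate f x y := by
  obtain ⟨C, hC⟩ := f.exists_abs_le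
  exact integral_pos_of_mem_support f.continuous hf hC ht hft

theorem translate_nonneg {f : K → ℝ} (hf : ∀ x, 0 ≤ f x) (x y : K) : 0 ≤ H.translate f x y :=
  integral_nonneg hf

theorem translate_eq_zero {f : K → ℝ} {x y : K}
    (hf : ∀ t ∈ (H.mul x y : Measure K).support, f t = 0) : H.translate f x y = 0 := by
  have := H.regular_mul x y
  exact integral_eq_zero_of_eqOn_support hf

end PointConvolution

/-! ### Associativity and inverses at the level of supports. -/

namespace Hypergroup

variable {K : Type*} [TopologicalSpace K] [T2Space K] [LocallyCompactSpace K]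
  [MeasurableSpace K] [BorelSpace K] (H : Hypergroup K)

/-- The point mass at `x` as an element of `M(K)`. -/
noncomputable def dirac (x : K) : PosMeasure K :=
  ⟨Measure.dirac x, inferInstance, regular_dirac_of_t1 x⟩

theorem _root_.PosMeasure.ext_of_integral_eq {μ ν : PosMeasure K}
    (h : ∀ f : C_c(K, ℝ), ∫ x, f x ∂μ.1 = ∫ x, f x ∂ν.1) : μ = ν := by
  have := μ.2.1
  have := μ.2.2
  have := ν.2.1
  have := ν.2.2
  exact Subtype.ext (Measure.ext_of_integral_eq_on_compactlySupported h)

theorem integral_convolve_dirac (μ : PosMeasure K) (y : K) (f : C_c(K, ℝ)) :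
    ∫ t, f t ∂(H.convolve μ (dirac y)).1 = ∫ x, H.translate f x y ∂μ.1 := by
  rw [H.integral_convolve]
  exact integral_dirac _ y

theorem integral_dirac_convolve (x : K) (ν : PosMeasure K) (f : C_c(K, ℝ)) :
    ∫ t, f t ∂(H.convolve (dirac x) ν).1 = ∫ y, H.translate f x y ∂ν.1 := by
  rw [H.integral_convolve]
  refine integral_congr_ae (Eventually.of_forall fun y => ?_)
  exact integral_dirac _ x

theorem convolve_dirac_dirac (x y : K) :
    H.convolve (dirac x) (dirac y) = ⟨H.mul x y, inferInstance, H.regular_mul x y⟩ :=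
  PosMeasure.ext_of_integral_eq fun f => by
    rw [integral_convolve_dirac]
    exact integral_dirac _ x

theorem translate_translate (f : C_c(K, ℝ)) (x y z : K) :
    H.translate (fun s => H.translate f s z) x y =
      H.translate (fun w => H.translate f x w) y z := by
  have h := congrArg (fun μ : PosMeasure K => ∫ t, f t ∂μ.1) (H.assoc (dirac x) (dirac y) (dirac z))
  rw [integral_convolve_dirac, integral_dirac_convolve, convolve_dirac_dirac,
    convolve_dirac_dirac] at h
  exact h

theorem mem_setMul {A B : Set K} {t : K} :
    t ∈ H.setMul A B ↔ ∃ x ∈ A, ∃ y ∈ B, t ∈ (H.mul x y : Measure K).support := by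
  simp [setMul]

/-- A Vietoris-continuous image of A × B is a compact family of compact sets, and the union of such
a family is compact. -/
theorem isCompact_setMul {A B : Set K} (hA : IsCompact A) (hB : IsCompact B) :
    IsCompact (H.setMul A B) := by
  let F : K × K → TopologicalSpace.Compacts K := fun p => ⟨_, H.isCompact_support p.1 p.2⟩
  have hF : Continuous F := by
    let := TopologicalSpace.vietoris K
    exact TopologicalSpace.Compacts.isEmbedding_coe.continuous_iff.2 H.continuous_support
  convert! TopologicalSpace.Compacts.isCompact_biUnion_coe_of_isCompact
    ((hA.prod hB).image hF) using 1
  ext t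
  simp [mem_setMul, F, and_assoc]

/-- Otherwise a nonnegative f separates t from the compact set x * (y * z). Its integral against δ_x
* (δ_y * δ_z) is then zero, while against (δ_x * δ_y) * δ_z it is positive. -/
theorem mem_setMul_left_of_mem {x y z w t : K} (hw : w ∈ (H.mul x y : Measure K).support)
    (ht : t ∈ (H.mul w z : Measure K).support) :
    t ∈ H.setMul {x} (H.mul y z : Measure K).support := by
  by_contra hn
  obtain ⟨f, h0, hft, hf⟩ := exists_separating
    (H.isCompact_setMul (isCompact_singleton (x := x)) (H.isCompact_support y z)).isClosed hn
  obtain ⟨C, hC⟩ := f.exists_abs_le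
  have h1 : H.translate (fun w => H.translate f x w) y z = 0 :=
    H.translate_eq_zero fun w hw => H.translate_eq_zero fun t ht =>
      hf t (H.mem_setMul.2 ⟨x, rfl, w, hw, ht⟩)
  have h2 : 0 < H.translate (fun s => H.translate f s z) x y :=
    integral_pos_of_mem_support
      ((H.continuous_translate f).comp (by fun_prop : Continuous fun s : K => (s, z)))
      (fun s => H.translate_nonneg h0 s z) (fun s => H.abs_translate_le hC s z) hw
      (H.translate_pos h0 ht hft)
  rw [H.translate_translate, h1] at h2
  exact lt_irrefl _ h2

theorem mem_setMul_right_of_mem {x y z w t : K} (hw : w ∈ (H.mul y z : Measure K).support)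
    (ht : t ∈ (H.mul x w : Measure K).support) :
    t ∈ H.setMul (H.mul x y : Measure K).support {z} := by
  by_contra hn
  obtain ⟨f, h0, hft, hf⟩ := exists_separating
    (H.isCompact_setMul (H.isCompact_support x y) (isCompact_singleton (x := z))).isClosed hn
  obtain ⟨C, hC⟩ := f.exists_abs_le
  have h1 : H.translate (fun s => H.translate f s z) x y = 0 :=
    H.translate_eq_zero fun w hw => H.translate_eq_zero fun t ht =>
      hf t (H.mem_setMul.2 ⟨w, hw, z, rfl, ht⟩)
  have h2 : 0 < H.translate (fun w => H.translate f x w) y z :=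
    integral_pos_of_mem_support
      ((H.continuous_translate f).comp (by fun_prop : Continuous fun w : K => (x, w)))
      (fun s => H.translate_nonneg h0 x s) (fun s => H.abs_translate_le hC x s) hw
      (H.translate_pos h0 ht hft)
  rw [← H.translate_translate, h1] at h2
  exact lt_irrefl _ h2

theorem inv_mem_support {x y t : K} (ht : t ∈ (H.mul x y : Measure K).support) :
    H.inv t ∈ (H.mul (H.inv y) (H.inv x) : Measure K).support := by
  rw [Measure.mem_support_iff_forall] at ht ⊢
  intro U hU
  obtain ⟨V, hVU, hV, htV⟩ := mem_nhds_iff.1 hU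
  rw [← H.map_inv_mul]
  refine lt_of_lt_of_le ?_ (measure_mono hVU)
  rw [Measure.map_apply H.continuous_inv.measurable hV.measurableSet]
  exact ht _ ((hV.preimage H.continuous_inv).mem_nhds htV)

/-- Substitute for y = x⁻¹t: e lies in ť * t, hence in (ť * x) * y, so ť * x contains y̌; apply the
involution. -/
theorem right_mem_support {x y t : K} (ht : t ∈ (H.mul x y : Measure K).support) :
    y ∈ (H.mul (H.inv x) t : Measure K).support := by
  have he : H.e ∈ (H.mul (H.inv t) t : Measure K).support := (H.e_mem_support_iff _ _).2 rfl
  obtain ⟨w, hw, z, hz, hez⟩ := H.mem_setMul.1 (H.mem_setMul_right_of_mem ht he)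
  rw [mem_singleton_iff.1 hz, H.e_mem_support_iff] at hez
  have := H.inv_mem_support hw
  rwa [hez, H.inv_inv, H.inv_inv] at this

theorem left_mem_support {x y t : K} (ht : t ∈ (H.mul x y : Measure K).support) :
    x ∈ (H.mul t (H.inv y) : Measure K).support := by
  have he : H.e ∈ (H.mul t (H.inv t) : Measure K).support :=
    (H.e_mem_support_iff _ _).2 (H.inv_inv t).symm
  obtain ⟨z, hz, w, hw, hez⟩ := H.mem_setMul.1 (H.mem_setMul_left_of_mem ht he)
  rw [mem_singleton_iff.1 hz, H.e_mem_support_iff] at hez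
  have := H.inv_mem_support hw
  rwa [← hez, H.inv_inv] at this

/-! ### Averages of translates and convolution of measures. -/

/-- If f(x * y) ≠ 0, some t in supp f lies in x * y, and then y lies in x̌ * t. Thus y is confined
to the compact set Š * supp f. -/
theorem locallyUniformlyVanishing_translate (f : C_c(K, ℝ)) :
    LocallyUniformlyVanishing (H.translate f) := by
  intro S hS
  refine ⟨_, H.isCompact_setMul (hS.image H.continuous_inv) f.hasCompactSupport,
    fun x hx y hy => H.translate_eq_zero fun t ht => ?_⟩
  by_contra hft
  exact hy (H.mem_setMul.2 ⟨_, mem_image_of_mem _ hx, t, subset_tsupport _ hft,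
    H.right_mem_support ht⟩)

theorem locallyUniformlyVanishing_translate_swap (f : C_c(K, ℝ)) :
    LocallyUniformlyVanishing fun y x => H.translate f x y := by
  intro S hS
  refine ⟨_, H.isCompact_setMul f.hasCompactSupport (hS.image H.continuous_inv),
    fun x hx y hy => H.translate_eq_zero fun t ht => ?_⟩
  by_contra hft
  exact hy (H.mem_setMul.2 ⟨t, subset_tsupport _ hft, _, mem_image_of_mem _ hx,
    H.left_mem_support ht⟩)

/-- `y ↦ ∫ f(x * y) dμ(x)`. -/
noncomputable def leftAverage (μ : PosMeasure K) (f : K → ℝ) (y : K) : ℝ :=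
  ∫ x, H.translate f x y ∂μ.1

/-- `x ↦ ∫ f(x * y) dν(y)`. -/
noncomputable def rightAverage (ν : PosMeasure K) (f : K → ℝ) (x : K) : ℝ :=
  ∫ y, H.translate f x y ∂ν.1

theorem continuous_leftAverage (μ : PosMeasure K) (f : C_c(K, ℝ)) :
    Continuous (H.leftAverage μ f) := by
  have := μ.2.1
  have := μ.2.2
  obtain ⟨C, hC⟩ := f.exists_abs_le
  exact continuous_integral_of_regular μ.1 (H.continuous_translate f) (H.abs_translate_le hC)

theorem continuous_rightAverage (ν : PosMeasure K) (f : C_c(K, ℝ)) :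
    Continuous (H.rightAverage ν f) := by
  have := ν.2.1
  have := ν.2.2
  obtain ⟨C, hC⟩ := f.exists_abs_le
  exact continuous_integral_of_regular ν.1 (φ := fun y x => H.translate f x y)
    ((H.continuous_translate f).comp continuous_swap) fun y x => H.abs_translate_le hC x y

theorem tendsto_leftAverage (μ : PosMeasure K) (f : C_c(K, ℝ)) :
    Tendsto (H.leftAverage μ f) (cocompact K) (𝓝 0) := by
  have := μ.2.1
  have := μ.2.2
  obtain ⟨C, hC⟩ := f.exists_abs_le
  exact (H.locallyUniformlyVanishing_translate f).tendsto_integral (H.continuous_translate f)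
    (H.abs_translate_le hC) μ.1

theorem tendsto_rightAverage (ν : PosMeasure K) (f : C_c(K, ℝ)) :
    Tendsto (H.rightAverage ν f) (cocompact K) (𝓝 0) := by
  have := ν.2.1
  have := ν.2.2
  obtain ⟨C, hC⟩ := f.exists_abs_le
  exact (H.locallyUniformlyVanishing_translate_swap f).tendsto_integral
    ((H.continuous_translate f).comp continuous_swap) (fun y x => H.abs_translate_le hC x y) ν.1

theorem integral_convolve_eq_integral_leftAverage (μ ν : PosMeasure K) (f : C_c(K, ℝ)) :
    ∫ t, f t ∂(H.convolve μ ν).1 = ∫ y, H.leftAverage μ f y ∂ν.1 :=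
  H.integral_convolve μ ν f

/-- The definition integrates over the left factor first; Fubini gives the other order, needed to
view convolution by σ on the right as an operator on functions. -/
theorem integral_convolve_eq_integral_rightAverage (μ ν : PosMeasure K) (f : C_c(K, ℝ)) :
    ∫ t, f t ∂(H.convolve μ ν).1 = ∫ x, H.rightAverage ν f x ∂μ.1 := by
  have := μ.2.1
  have := μ.2.2
  have := ν.2.1
  have := ν.2.2
  obtain ⟨C, hC⟩ := f.exists_abs_le
  rw [H.integral_convolve]
  exact (H.locallyUniformlyVanishing_translate f).integral_integral_swap
    (H.continuous_translate f) (H.abs_translate_le hC) μ.1 ν.1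

theorem convolve_univ_le_one {μ ν : PosMeasure K} (hμ : μ.1 univ ≤ 1) (hν : ν.1 univ ≤ 1) :
    (H.convolve μ ν).1 univ ≤ 1 := by
  have := (H.convolve μ ν).2.1
  have := (H.convolve μ ν).2.2
  rw [isOpen_univ.measure_eq_iSup_isCompact]
  refine iSup₂_le fun S _ => iSup_le fun hS => ?_
  obtain ⟨χ, h0, h1, hχS⟩ := exists_cutoff hS
  have hχ : ∀ x, |χ x| ≤ 1 := fun x => abs_le.2 ⟨by linarith [h0 x], h1 x⟩
  have hle : ∫ t, χ t ∂(H.convolve μ ν).1 ≤ 1 := by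
    rw [H.integral_convolve]
    exact (le_abs_self _).trans (abs_integral_le_of_measure_le_one hν zero_le_one fun y =>
      abs_integral_le_of_measure_le_one hμ zero_le_one fun x => H.abs_translate_le hχ x y)
  have hχi : Integrable (fun x => χ x) (H.convolve μ ν).1 :=
    integrable_of_continuous_of_bounded χ.continuous hχ
  have hS1 : (H.convolve μ ν).1.real S ≤ 1 := by
    refine le_trans ?_ hle
    rw [← integral_indicator_one hS.measurableSet]
    refine integral_mono ((integrable_const 1).indicator hS.measurableSet) hχi fun x => ?_
    by_cases hx : x ∈ S
    · simp [hx, hχS x hx]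
    · simpa [hx] using h0 x
  rw [← ENNReal.ofReal_one]
  exact (ENNReal.le_ofReal_iff_toReal_le (measure_ne_top _ _) zero_le_one).2 hS1

/-! ### Supports of convolutions and non-degeneracy. -/

theorem support_subset_support_convolve {μ ν : PosMeasure K} {x y t : K} (hx : x ∈ μ.1.support)
    (hy : y ∈ ν.1.support) (ht : t ∈ (H.mul x y : Measure K).support) :
    t ∈ (H.convolve μ ν).1.support := by
  have := μ.2.1
  have := ν.2.1
  have := (H.convolve μ ν).2.2
  by_contra hn
  obtain ⟨f, h0, hft, hf⟩ := exists_separating Measure.isClosed_support hn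
  obtain ⟨C, hC⟩ := f.exists_abs_le
  have h1 : ∫ t, f t ∂(H.convolve μ ν).1 = 0 := integral_eq_zero_of_eqOn_support hf
  rw [H.integral_convolve_eq_integral_leftAverage] at h1
  refine (integral_pos_of_mem_support (H.continuous_leftAverage μ f)
    (fun y => integral_nonneg fun x => H.translate_nonneg h0 x y)
    (fun y => abs_integral_le_mul fun x => H.abs_translate_le hC x y) hy ?_).ne' h1
  exact integral_pos_of_mem_support
    ((H.continuous_translate f).comp (by fun_prop : Continuous fun s : K => (s, y)))
    (fun x => H.translate_nonneg h0 x y) (fun x => H.abs_translate_le hC x y) hx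
    (H.translate_pos h0 ht hft)

/-- A closed set stable under left multiplication by the support of a non-degenerate measure is
empty or everything. -/
theorem eq_univ_of_setMul_subset {σ : PosMeasure K} (hσ : H.IsNondegenerate σ) {A : Set K}
    (hA : IsClosed A) (hne : A.Nonempty) (hσA : H.setMul σ.1.support A ⊆ A) : A = univ := by
  have hpow : ∀ n, ∀ s ∈ H.setPow σ.1.support n, ∀ a ∈ A,
      (H.mul s a : Measure K).support ⊆ A := by
    intro n
    induction n with
    | zero =>
      intro s hs a ha
      rw [mem_singleton_iff.1 hs, H.e_mul]
      exact Measure.support_subset_of_isClosed hA (by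
        rw [mem_ae_iff, Measure.dirac_apply' _ hA.measurableSet.compl]
        simpa using ha)
    | succ n ih =>
      intro s hs a ha t ht
      obtain ⟨x, hx, y, hy, hs⟩ := H.mem_setMul.1 hs
      obtain ⟨x', hx', w, hw, htw⟩ := H.mem_setMul.1 (H.mem_setMul_left_of_mem hs ht)
      rw [mem_singleton_iff.1 hx'] at htw
      exact ih x hx w (hσA (H.mem_setMul.2 ⟨y, hy, a, ha, hw⟩)) htw
  obtain ⟨a, ha⟩ := hne
  -- For a nonnegative f vanishing on A, the set of s with f(s * a) > 0 is open, so it would meet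
  -- the dense union of powers of supp σ, where f(s * a) = 0.
  have hall : ∀ z, (H.mul z a : Measure K).support ⊆ A := by
    intro z t ht
    by_contra htA
    obtain ⟨f, h0, hft, hf⟩ := exists_separating hA htA
    have hc : Continuous fun s => H.translate f s a :=
      (H.continuous_translate f).comp (by fun_prop : Continuous fun s : K => (s, a))
    have hz : z ∈ closure (⋃ n : ℕ, ⋃ _ : 1 ≤ n, H.setPow σ.1.support n) := by
      rw [hσ]
      exact mem_univ z
    obtain ⟨s, hs, hsn⟩ := mem_closure_iff.1 hz _ (isOpen_lt continuous_const hc)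
      (H.translate_pos h0 ht hft)
    simp only [mem_iUnion] at hsn
    obtain ⟨n, -, hn⟩ := hsn
    exact (ne_of_gt hs) (H.translate_eq_zero fun t ht => hf t (hpow n s hn a ha ht))
  refine eq_univ_of_forall fun y => ?_
  -- Since e lies in ǎ * a, y lies in y * (ǎ * a), hence in (y * ǎ) * a: every y lies in some w * a.
  have he : H.e ∈ (H.mul (H.inv a) a : Measure K).support := (H.e_mem_support_iff _ _).2 rfl
  have hy : y ∈ (H.mul y H.e : Measure K).support := by
    rw [H.mul_e]
    exact mem_support_dirac y
  obtain ⟨w, -, a', ha', hyw⟩ := H.mem_setMul.1 (H.mem_setMul_right_of_mem he hy)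
  rw [mem_singleton_iff.1 ha'] at hyw
  exact hall w hyw

/-! ### Harmonic functions and the maximum principle. -/

/-- Both sides integrate f, against μ * δ_y and μ * (σ * δ_y) = (μ * σ) * δ_y = μ * δ_y. -/
theorem leftAverage_eq_integral {μ σ : PosMeasure K} (h : H.convolve μ σ = μ) (f : C_c(K, ℝ))
    (y : K) : H.leftAverage μ f y = ∫ z, H.leftAverage μ f z ∂(H.convolve σ (dirac y)).1 := by
  rw [← H.integral_convolve_eq_integral_leftAverage, ← H.assoc, h, integral_convolve_dirac]
  rfl

/-- The maximum principle for `σ`-harmonic functions vanishing at infinity. -/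
theorem nonpos_of_harmonic [NoncompactSpace K] {σ : PosMeasure K} (hσ1 : σ.1 univ ≤ 1)
    (hσ : H.IsNondegenerate σ) {g : K → ℝ} (hg : Continuous g)
    (hg0 : Tendsto g (cocompact K) (𝓝 0))
    (hharm : ∀ y, g y = ∫ z, g z ∂(H.convolve σ (dirac y)).1) (y : K) : g y ≤ 0 := by
  by_contra! hy
  -- Outside a compact set g stays below the positive value `g y`, so the maximum is attained.
  obtain ⟨x₀, hx₀⟩ := hg.exists_forall_ge' y
    ((hg0.eventually_lt_const hy).mono fun x hx => hx.le)
  have hM : 0 < g x₀ := hy.trans_le (hx₀ y)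
  obtain ⟨C, hC⟩ := exists_abs_le_of_tendsto_cocompact hg hg0
  have hA : {x | g x = g x₀} = univ := by
    refine H.eq_univ_of_setMul_subset hσ (isClosed_eq hg continuous_const) ⟨x₀, rfl⟩ ?_
    intro t ht
    obtain ⟨s, hs, a, ha, ht⟩ := H.mem_setMul.1 ht
    have hfin := (H.convolve σ (dirac a)).2.1
    have hmass := H.convolve_univ_le_one hσ1 (ν := dirac a)
      (by change Measure.dirac a univ ≤ 1; simp)
    by_contra hne
    have hlt : g t < g x₀ := lt_of_le_of_ne (hx₀ t) hne
    -- The deficit g(x₀) - g is nonnegative and positive at the support point t of σ * δ_a. Yet its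
    -- integral is at most g(x₀) - g(a) = 0, since the mass is at most one and g(x₀) > 0.
    have hpos := integral_pos_of_mem_support (μ := (H.convolve σ (dirac a)).1)
      (g := fun x => g x₀ - g x) (continuous_const.sub hg) (fun x => sub_nonneg.2 (hx₀ x))
      (C := |g x₀| + C) (fun x => (abs_sub _ _).trans (add_le_add le_rfl (hC x)))
      (H.support_subset_support_convolve hs (mem_support_dirac a) ht) (sub_pos.2 hlt)
    rw [integral_sub (integrable_const _) (integrable_of_continuous_of_bounded hg hC),
      ← hharm a, show g a = g x₀ from ha] at hpos
    have := (le_abs_self _).trans (abs_integral_le_of_measure_le_one hmass hM.le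
      (g := fun _ => g x₀) fun _ => (abs_of_pos hM).le)
    linarith
  have hconst : g = fun _ => g x₀ := funext fun x => (hA.symm ▸ mem_univ x : x ∈ {x | g x = g x₀})
  rw [hconst] at hg0
  exact hM.ne' (tendsto_nhds_unique tendsto_const_nhds hg0)

theorem integral_eq_zero_of_convolve_eq_self [NoncompactSpace K] {σ : PosMeasure K}
    (hσ1 : σ.1 univ ≤ 1) (hσ : H.IsNondegenerate σ) {μ : PosMeasure K}
    (h : H.convolve μ σ = μ) (f : C_c(K, ℝ)) : ∫ x, f x ∂μ.1 = 0 := by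
  have key : ∀ f : C_c(K, ℝ), ∫ x, f x ∂μ.1 ≤ 0 := fun f => by
    -- Evaluation at e recovers ∫ f dμ, because δ_x * δ_e = δ_x.
    have := H.nonpos_of_harmonic hσ1 hσ (H.continuous_leftAverage μ f)
      (H.tendsto_leftAverage μ f) (H.leftAverage_eq_integral h f) H.e
    refine le_trans (le_of_eq (integral_congr_ae (Eventually.of_forall fun x => ?_))) this
    change f x = ∫ t, f t ∂(H.mul x H.e : Measure K)
    rw [H.mul_e, integral_dirac]
  refine le_antisymm (key f) ?_
  have := key (-f)
  simp only [CompactlySupportedContinuousMap.coe_neg, Pi.neg_apply, integral_neg] at this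
  linarith

/-! ### Cesàro averages and their limit points. -/

theorem power_univ_le_one {σ : PosMeasure K} (hσ1 : σ.1 univ ≤ 1) (n : ℕ) :
    (H.power σ n).1 univ ≤ 1 := by
  induction n with
  | zero =>
    change Measure.dirac H.e univ ≤ 1
    simp
  | succ n ih => exact H.convolve_univ_le_one ih hσ1

theorem cesaro_univ_le_one {σ : PosMeasure K} (hσ1 : σ.1 univ ≤ 1) (n : ℕ) :
    H.cesaro σ n univ ≤ 1 := by
  -- For n = 0 the convention 0⁻¹ = 0 makes the average the zero measure.
  rcases Nat.eq_zero_or_pos n with rfl | hn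
  · simp [cesaro]
  have h : ∑ k ∈ Finset.Icc 1 n, (H.power σ k).1 univ ≤ n := by
    refine (Finset.sum_le_card_nsmul _ _ 1 fun k _ => H.power_univ_le_one hσ1 k).trans ?_
    simp
  rw [cesaro, Measure.smul_apply, Measure.finsetSum_apply, ENNReal.smul_def, smul_eq_mul,
    ENNReal.coe_inv (by positivity), ENNReal.coe_natCast]
  refine (mul_le_mul_right h _).trans ?_
  rw [ENNReal.inv_mul_cancel (by positivity) (ENNReal.natCast_ne_top n)]

theorem integral_cesaro (σ : PosMeasure K) (n : ℕ) {g : K → ℝ} (hg : Continuous g) {C : ℝ}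
    (hC : ∀ x, |g x| ≤ C) :
    ∫ x, g x ∂(H.cesaro σ n) = (n : ℝ)⁻¹ * ∑ k ∈ Finset.Icc 1 n, ∫ x, g x ∂(H.power σ k).1 := by
  have hfin : ∀ k, IsFiniteMeasure (H.power σ k).1 := fun k => (H.power σ k).2.1
  rw [cesaro, integral_smul_nnreal_measure, integral_finsetSum_measure fun k _ =>
    integrable_of_continuous_of_bounded hg hC, NNReal.smul_def]
  simp

/-- Convolving the averages with `σ` changes them by a vanishing amount. -/
theorem tendsto_integral_rightAverage_sub {σ : PosMeasure K} (hσ1 : σ.1 univ ≤ 1)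
    (f : C_c(K, ℝ)) :
    Tendsto (fun n => ∫ x, H.rightAverage σ f x ∂(H.cesaro σ n) - ∫ x, f x ∂(H.cesaro σ n))
      atTop (𝓝 0) := by
  obtain ⟨C, hC⟩ := f.exists_abs_le
  obtain ⟨D, hD⟩ := exists_abs_le_of_tendsto_cocompact (H.continuous_rightAverage σ f)
    (H.tendsto_rightAverage σ f)
  have hCe : 0 ≤ C := (abs_nonneg _).trans (hC H.e)
  have hb : ∀ k, |∫ x, f x ∂(H.power σ k).1| ≤ C := fun k =>
    abs_integral_le_of_measure_le_one (H.power_univ_le_one hσ1 k) hCe hC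
  refine squeeze_zero_norm (a := fun n : ℕ => (n : ℝ)⁻¹ * (2 * C)) (fun n => ?_) (by
    simpa using tendsto_inv_atTop_nhds_zero_nat.mul_const (2 * C))
  rw [H.integral_cesaro σ n (H.continuous_rightAverage σ f) hD,
    H.integral_cesaro σ n (g := f) f.continuous hC, ← mul_sub, norm_mul, norm_inv, Real.norm_natCast]
  refine mul_le_mul_of_nonneg_left ?_ (by positivity)
  -- Integrating `rightAverage σ f` against σᵏ is integrating f against σᵏ⁺¹, so only the end terms
  -- survive.
  have htel : ∑ k ∈ Finset.Icc 1 n, ∫ x, H.rightAverage σ f x ∂(H.power σ k).1 -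
      ∑ k ∈ Finset.Icc 1 n, ∫ x, f x ∂(H.power σ k).1 =
      ∫ x, f x ∂(H.power σ (n + 1)).1 - ∫ x, f x ∂(H.power σ 1).1 := by
    rw [← Finset.sum_sub_distrib]
    simp_rw [← H.integral_convolve_eq_integral_rightAverage]
    rw [← Finset.Ico_add_one_right_eq_Icc]
    exact Finset.sum_Ico_sub (fun k => ∫ x, f x ∂(H.power σ k).1) (by omega)
  rw [htel, Real.norm_eq_abs]
  exact (abs_sub _ _).trans (by linarith [hb (n + 1), hb 1])

theorem tendsto_integral_cesaro [NoncompactSpace K] {σ : PosMeasure K} (hσ1 : σ.1 univ ≤ 1)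
    (hσ : H.IsNondegenerate σ) (f : C_c(K, ℝ)) :
    Tendsto (fun n => ∫ x, f x ∂(H.cesaro σ n)) atTop (𝓝 0) := by
  rw [tendsto_iff_ultrafilter]
  intro U hU
  obtain ⟨μ, hreg, hμ1, hμ⟩ := exists_regular_tendsto_ultrafilter U
    (m := fun n => H.cesaro σ n) (H.cesaro_univ_le_one hσ1)
  let μ' : PosMeasure K := ⟨μ, ⟨hμ1.trans_lt ENNReal.one_lt_top⟩, hreg⟩
  have hinv : H.convolve μ' σ = μ' := PosMeasure.ext_of_integral_eq fun f => by
    rw [H.integral_convolve_eq_integral_rightAverage]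
    -- The right average is only in `C₀(K)`, so convergence on `C_c(K)` must first be extended,
    -- using the uniform mass bound.
    have h1 := tendsto_integral_of_tendsto_compactlySupported (H.cesaro_univ_le_one hσ1) hμ1 hμ
      (H.continuous_rightAverage σ f) (H.tendsto_rightAverage σ f)
    have h2 := tendsto_nhds_unique (h1.sub (hμ f))
      ((H.tendsto_integral_rightAverage_sub hσ1 f).mono_left hU)
    exact sub_eq_zero.1 h2
  have h0 : ∫ x, f x ∂μ = 0 := H.integral_eq_zero_of_convolve_eq_self hσ1 hσ hinv f
  have := hμ f
  rwa [h0] at this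

end Hypergroup

theorem mainTheorem12 {K : Type*} [TopologicalSpace K] [T2Space K] [LocallyCompactSpace K]
    [NoncompactSpace K] [MeasurableSpace K] [BorelSpace K] (H : Hypergroup K)
    (ω : Measure K) (hω : H.IsLeftHaar ω)
    (σ : PosMeasure K) (hσ₁ : IsProbabilityMeasure σ.1) (hσ : H.IsNondegenerate σ) :
    ∀ f : C₀(K, ℂ),
      Tendsto (fun n : ℕ => ∫ x, f x ∂(H.cesaro σ n)) atTop (𝓝 0) := by
  intro f
  have hσ1 : σ.1 univ ≤ 1 := measure_univ.le
  have hm := H.cesaro_univ_le_one hσ1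
  have hfin : ∀ n, IsFiniteMeasure (H.cesaro σ n) := fun n =>
    ⟨(hm n).trans_lt ENNReal.one_lt_top⟩
  -- The limit is written as an integral against the zero measure so that the extension from
  -- `C_c(K)` to `C₀(K)` applies; real and imaginary parts then give complex f.
  have h0 : ∀ g : C_c(K, ℝ), Tendsto (fun n => ∫ x, g x ∂(H.cesaro σ n)) atTop
      (𝓝 (∫ x, g x ∂(0 : Measure K))) := fun g => by
    simpa using H.tendsto_integral_cesaro hσ1 hσ g
  have hreal : ∀ k : K → ℝ, Continuous k → Tendsto k (cocompact K) (𝓝 0) →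
      Tendsto (fun n => ∫ x, k x ∂(H.cesaro σ n)) atTop (𝓝 0) := fun k hk hk0 => by
    simpa using tendsto_integral_of_tendsto_compactlySupported hm (by simp) h0 hk hk0
  have hre0 : Tendsto (fun x => (f x).re) (cocompact K) (𝓝 0) :=
    (Complex.continuous_re.tendsto 0).comp f.zero_at_infty'
  have him0 : Tendsto (fun x => (f x).im) (cocompact K) (𝓝 0) :=
    (Complex.continuous_im.tendsto 0).comp f.zero_at_infty'
  have hre : Continuous fun x => (f x).re := Complex.continuous_re.comp f.continuous
  have him : Continuous fun x => (f x).im := Complex.continuous_im.comp f.continuous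
  obtain ⟨C, hC⟩ := exists_abs_le_of_tendsto_cocompact hre hre0
  obtain ⟨D, hD⟩ := exists_abs_le_of_tendsto_cocompact him him0
  have hfi : ∀ n, Integrable (fun x => f x) (H.cesaro σ n) := fun n =>
    Integrable.re_im_iff.1 ⟨integrable_of_continuous_of_bounded hre hC,
      integrable_of_continuous_of_bounded him hD⟩
  have hsum := ((Complex.continuous_ofReal.tendsto 0).comp (hreal _ hre hre0)).add
    (((Complex.continuous_ofReal.tendsto 0).comp (hreal _ him him0)).mul_const Complex.I)
  simp only [Complex.ofReal_zero, zero_mul, add_zero] at hsum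
  refine hsum.congr fun n => ?_
  exact integral_re_add_im (hfi n)
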